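/- Let $0<h<J$ and, for $\beta>0$, let $$M_z(\beta)=-\frac12+\frac1{2\pi}\int_{-\pi}^{\pi}\frac{dk}{e^{-\beta(h+J\cos k)}+1}$$ be the magnetization per site, at inverse temperature $\beta$, of the infinite spin-$\tfrac12$ XX chain with exchange constant $J$ in the transverse field $h$. For an integer $s\ge 1$ and real $x<1$ let $\mathrm{Li}_s(x)=\frac{x}{\Gamma(s)}\int_0^\infty\frac{t^{s-1}}{e^t-x}\,dt$ be the polylogarithm (the analytic continuation of $\sum_{k\ge1}x^k/k^s$, $|x|<1$). Then, as $\beta\to\infty$, $$M_z\sim\sum_{n\ge0}f_n(\beta),\qquad f_n(\beta)=-\frac{[(2n-1)!!]^2}{\pi(\beta J)^{2n+1}}\,\mathrm{Li}_{2n+1}(-e^{\beta h}),\qquad (-1)!!=1,$$ that is, $$M_z\sim-\frac1{\pi\beta J}\mathrm{Li}_1(-e^{\beta h})-\frac1{\pi(\beta J)^3}\mathrm{Li}_3(-e^{\beta h})-\frac9{\pi(\beta J)^5}\mathrm{Li}_5(-e^{\beta h})-\cdots .$$ The series diverges for every $\beta$, and each $f_n(\beta)$ tends to a non-zero constant as $\beta\to\infty$;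 the relation $\sim$, with small parameter $\varepsilon=1/\beta$, means the following three things together. 1. For every $N\ge0$, $M_z-\sum_{n<N}f_n=O(f_N)$ as $\beta\to\infty$. 2. The two sides have the same expansion in powers of $\varepsilon$ to all orders, the right-hand side being expanded term by term: there are real numbers $a_{n,m}$ $(n,m\ge0)$ such that $f_n\sim\sum_m a_{n,m}\varepsilon^m$ for every $n$, the series $\sum_n a_{n,m}$ converges absolutely for every $m$, and $M_z\sim\sum_m\bigl(\sum_n a_{n,m}\bigr)\varepsilon^m$. (Here $g\sim\sum_m b_m\varepsilon^m$ has the usual meaning $g-\sum_{m<K}b_m\varepsilon^m=O(\varepsilon^K)$ for every $K\ge0$.) 3. Suitably truncated, the series gives $M_z$ beyond all orders: there is $N(\beta)\in\mathbb N$ with $N(\beta)\to\infty$ as $\beta\to\infty$ and $M_z-\sum_{n<N(\beta)}f_n(\beta)=O(\varepsilon^K)$ for every $K\ge 0$. Equivalently, in terms of the temperature $T$, for every value $k_B>0$ of the Boltzmann constant and $\beta=1/(k_BT)$, $$M_z\sim-\mathcal Q_1(T)\,T-\mathcal Q_3(T)\,T^3-\mathcal Q_5(T)\,T^5-\cdots\quad(T\to0^+),\qquad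 \mathcal Q_{2n+1}(T)=\frac{k_B^{2n+1}[(2n-1)!!]^2}{\pi J^{2n+1}}\,\mathrm{Li}_{2n+1}\bigl(-e^{h/(k_BT)}\bigr),$$ in the same sense 1–3, with small parameter $\varepsilon=T$ and terms $-\mathcal Q_{2n+1}(T)T^{2n+1}$. -/

import Mathlib

open MeasureTheory Filter Topology Asymptotics
open scoped Nat

/-- Magnetization per site of the infinite XX chain at inverse temperature `β`, with exchange
constant `J` and transverse field `h`: the modes have energy `ω k = -J cos k - h`, Fermi-Dirac
occupation `1 / (exp (β ω k) + 1)`, and `k` is uniform on the Brillouin zone `[-π, π]`. -/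
noncomputable def magnetization (J h β : ℝ) : ℝ :=
  -1 / 2 + 1 / (2 * Real.pi) *
    ∫ k in (-Real.pi)..Real.pi, 1 / (Real.exp (-(β * (h + J * Real.cos k))) + 1)

/-- The polylogarithm `Li_n(x)` of integer order `n ≥ 1` at real `x < 1`, i.e. the analytic
continuation of `∑_{k ≥ 1} x ^ k / k ^ n` from `(-1, 1)` to `(-∞, 1)`:
`Li_n(x) = (x / Γ(n)) ∫_0^∞ t ^ (n - 1) / (e ^ t - x) dt`. -/
noncomputable def polylog (n : ℕ) (x : ℝ) : ℝ :=
  x / ((n - 1)! : ℝ) * ∫ t in Set.Ioi (0 : ℝ), t ^ (n - 1) / (Real.exp t - x)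

/-- Inside the unit disc `polylog` is the sum of the defining power series. -/
theorem hasSum_polylog (n : ℕ) (hn : 1 ≤ n) (x : ℝ) (hx : |x| < 1) :
    HasSum (fun k : ℕ => x ^ (k + 1) / ((k : ℝ) + 1) ^ n) (polylog n x) := by
  obtain ⟨m, rfl⟩ : ∃ m, n = m + 1 := ⟨n - 1, by omega⟩
  have hm : ((m ! : ℕ) : ℝ) ≠ 0 := by exact_mod_cast Nat.factorial_ne_zero m
  have hint : ∀ k : ℕ, ∫ t in Set.Ioi (0 : ℝ), t ^ m * Real.exp (-(((k : ℝ) + 1) * t))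
      = (m ! : ℝ) / ((k : ℝ) + 1) ^ (m + 1) := by
    intro k
    have := Real.integral_rpow_mul_exp_neg_mul_Ioi (a := (m : ℝ) + 1) (r := (k : ℝ) + 1)
      (by positivity) (by positivity)
    rw [Real.Gamma_nat_eq_factorial] at this
    simp only [add_sub_cancel_right, Real.rpow_natCast] at this
    rw [this]
    rw [show (m : ℝ) + 1 = ((m + 1 : ℕ) : ℝ) by push_cast; ring, Real.rpow_natCast]
    rw [div_pow, one_pow]; ring
  have hI : ∀ k : ℕ, IntegrableOn (fun t : ℝ => t ^ m * Real.exp (-(((k : ℝ) + 1) * t)))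
      (Set.Ioi 0) := by
    intro k
    by_contra hcon
    have h0 := hint k
    rw [integral_undef hcon] at h0
    have : (m ! : ℝ) / ((k : ℝ) + 1) ^ (m + 1) ≠ 0 := by positivity
    exact this h0.symm
  have hsum : Summable fun k : ℕ => |x| ^ k * ((m ! : ℝ) / ((k : ℝ) + 1) ^ (m + 1)) := by
    refine Summable.of_nonneg_of_le (fun k => by positivity) (fun k => ?_)
      ((summable_geometric_of_lt_one (abs_nonneg x) hx).mul_right (m ! : ℝ))
    refine mul_le_mul_of_nonneg_left (div_le_self (by positivity) ?_) (by positivity)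
    exact one_le_pow₀ (by linarith [Nat.cast_nonneg (α := ℝ) k])
  have key := hasSum_integral_of_summable_integral_norm
    (μ := volume.restrict (Set.Ioi (0 : ℝ)))
    (F := fun (k : ℕ) (t : ℝ) => x ^ k * (t ^ m * Real.exp (-(((k : ℝ) + 1) * t))))
    (fun k => (hI k).const_mul _) (by
      refine hsum.congr (fun k => ?_)
      rw [← hint k, ← integral_const_mul]
      refine setIntegral_congr_fun measurableSet_Ioi (fun t ht => ?_)
      have ht' : 0 ≤ t := le_of_lt ht
      simp only [norm_mul, norm_pow, Real.norm_eq_abs, Real.abs_exp, abs_of_nonneg ht'])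
  have hfun : ∫ t in Set.Ioi (0 : ℝ), ∑' k : ℕ, x ^ k * (t ^ m * Real.exp (-(((k : ℝ) + 1) * t)))
      = ∫ t in Set.Ioi (0 : ℝ), t ^ m / (Real.exp t - x) := by
    refine setIntegral_congr_fun measurableSet_Ioi (fun t ht => ?_)
    have ht' : (0 : ℝ) < t := ht
    have he : Real.exp (-t) < 1 := by simpa using ht'
    have hr : |x * Real.exp (-t)| < 1 := by
      rw [abs_mul, Real.abs_exp]
      nlinarith [abs_nonneg x, Real.exp_pos (-t)]
    have hg := (hasSum_geometric_of_abs_lt_one hr).mul_left (t ^ m * Real.exp (-t))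
    have hk : (fun k : ℕ => x ^ k * (t ^ m * Real.exp (-(((k : ℝ) + 1) * t))))
        = fun k : ℕ => t ^ m * Real.exp (-t) * (x * Real.exp (-t)) ^ k := by
      funext k
      rw [mul_pow, ← Real.exp_nat_mul,
        show -(((k : ℝ) + 1) * t) = -t + (k : ℝ) * -t by ring, Real.exp_add]
      ring
    change ∑' k : ℕ, x ^ k * (t ^ m * Real.exp (-(((k : ℝ) + 1) * t)))
      = t ^ m / (Real.exp t - x)
    rw [hk, hg.tsum_eq]
    have h1 : Real.exp t * Real.exp (-t) = 1 := by rw [← Real.exp_add]; simp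
    have h2 : 1 - x * Real.exp (-t) ≠ 0 := by
      have := (abs_lt.mp hr).2
      linarith
    have h3 : Real.exp t - x ≠ 0 := by
      have := (abs_lt.mp hx).2
      have := Real.one_lt_exp_iff.mpr ht'
      linarith
    rw [← div_eq_mul_inv, div_eq_div_iff h2 h3]
    linear_combination (t ^ m) * h1
  rw [hfun] at key
  have := key.mul_left (x / (m ! : ℝ))
  have hp : polylog (m + 1) x
      = x / (m ! : ℝ) * ∫ t in Set.Ioi (0 : ℝ), t ^ m / (Real.exp t - x) := by
    simp [polylog]
  rw [hp]
  have hterm : (fun k : ℕ => x ^ (k + 1) / ((k : ℝ) + 1) ^ (m + 1)) = fun k : ℕ =>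
      x / (m ! : ℝ) * ∫ t in Set.Ioi (0 : ℝ),
        x ^ k * (t ^ m * Real.exp (-(((k : ℝ) + 1) * t))) := by
    funext k
    rw [integral_const_mul, hint k]
    field_simp
    exact pow_succ' x k
  rw [hterm]
  exact this

/-- `f` has the asymptotic power expansion `f ∼ ∑ m, a m * ε ^ m` along `l`
(`ε` is the small parameter, `ε → 0` along `l`). -/
def HasPowerExpansion {α : Type*} (l : Filter α) (ε f : α → ℝ) (a : ℕ → ℝ) : Prop :=
  ∀ K : ℕ, (fun x => f x - ∑ m ∈ Finset.range K, a m * ε x ^ m) =O[l] fun x => ε x ^ K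

/-- `f ∼ term 0 + term 1 + term 2 + ⋯` along `l`, with small parameter `ε`, for a (possibly
divergent) series whose terms need not tend to zero with `ε`. -/
structure IsAsymptoticSeries {α : Type*} (l : Filter α) (ε f : α → ℝ) (term : ℕ → α → ℝ) :
    Prop where
  /-- Cutting the series anywhere leaves an error of the order of the first omitted term. -/
  remainder : ∀ N : ℕ, (fun x => f x - ∑ n ∈ Finset.range N, term n x) =O[l] term N
  /-- Expanding every term in powers of `ε` and adding up the coefficients of each power (a
  convergent sum) gives the expansion of `f` in powers of `ε`, to all orders. -/
  termwise : ∃ a : ℕ → ℕ → ℝ, (∀ n, HasPowerExpansion l ε (term n) (a n)) ∧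
    (∀ m, Summable fun n => a n m) ∧ HasPowerExpansion l ε f fun m => ∑' n, a n m
  /-- Suitably truncated, with more and more terms as `ε → 0`, the series gives `f` with an error
  smaller than every power of `ε`. -/
  truncation : ∃ N : α → ℕ, Tendsto N l atTop ∧
    ∀ K : ℕ, (fun x => f x - ∑ n ∈ Finset.range (N x), term n x) =O[l] fun x => ε x ^ K

/-- The `n`-th term `-((2n-1)!!)² / (π (βJ)^(2n+1)) * Li_{2n+1}(-e^{βh})`, `n = 0, 1, 2, …`, of the
low-temperature series; here `(-1)!! = 1`, so the numerators are `1, 1, 9, 225, …`. -/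
noncomputable def magnetizationTerm (J h : ℝ) (n : ℕ) (β : ℝ) : ℝ :=
  -(((2 * n - 1)‼ : ℝ) ^ 2 / (Real.pi * (β * J) ^ (2 * n + 1))) *
    polylog (2 * n + 1) (-Real.exp (β * h))

/-- The temperature-dependent coefficient `Q_{2n+1}(T)`, with `kB` the Boltzmann constant. -/
noncomputable def blochCoeff (kB J h : ℝ) (n : ℕ) (T : ℝ) : ℝ :=
  kB ^ (2 * n + 1) * ((2 * n - 1)‼ : ℝ) ^ 2 / (Real.pi * J ^ (2 * n + 1)) *
    polylog (2 * n + 1) (-Real.exp (h / (kB * T)))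

/-!
With `σ(x) = 1 / (e ^ x + 1)` and `c_n = ((2n-1)!!)² / (2n)!`, the substitution `s = -J cos k` on
the modes with `cos k < 0`, and the integral representation of the polylogarithm, give
`π M_z = ∫_0^J σ(β(s - h)) / √(J² - s²) ds + O(e ^ (-βh))` (`abs_magnetization_sub_le`) and
`π f_n = ∫_0^∞ σ(β(s - h)) c_n s ^ (2n) / J ^ (2n+1) ds` (`magnetizationTerm_eq`). The modes with
`cos k ≥ 0` only cancel the constant `-1/2`. Since the `c_n` are the coefficients of
`(1 - x) ^ (-1/2)`, the series `∑ f_n` is the one obtained by expanding `1 / √(J² - s²)` in powers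
of `s` and integrating each power over the whole half-line, beyond the radius of convergence `J`;
that is why it diverges.

The error committed in this way is beyond all orders, because `h < J`: fix `δ` with `h + δ < J`.
The function `σ(β(s - h))` differs from the step at `h` by at most `e ^ (-β|s - h|)`, so that only
`|s - h| ≤ δ` matters for an expansion in powers of `1/β`, and there the Sommerfeld expansion
(`hasPowerExpansion_sommerfeld`) reads the coefficients off from the Taylor expansion at `h`. On
that interval the series of `1 / √(J² - s²)` converges, and since the `c_n` and the binomial
coefficients are positive, the Taylor remainders of its terms are bounded by a summable sequence.
Hence Taylor expansion commutes with the sum over `n` (`exists_abs_bandDensity_sub_sum_le`,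
`hasSum_sommerfeldCoeff`), which is the termwise expansion.

The remainder estimate follows, since `M_z` and all `f_n` are bounded and `f_n` has a positive
limit. For the truncation, take `N` terms with `N` a small multiple of `β`. For `s ≤ h + δ`
the partial sum is within `O(((h + δ) / J) ^ (2N))` of `1 / √(J² - s²)`, which is exponentially
small in `β`; for `s ≥ h + δ` it is at most `N e ^ (2Ns/J) / J`, and half of the decay
`e ^ (-β(s - h))` suffices to absorb it (`abs_bandDensity_sub_sum_mul_fermi_le`).
-/

/-! ### The Fermi function -/

/-- The Fermi function `1 / (e ^ x + 1)`. -/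
noncomputable def fermi (x : ℝ) : ℝ := 1 / (Real.exp x + 1)

theorem fermi_pos (x : ℝ) : 0 < fermi x := by unfold fermi; positivity

theorem fermi_le_one (x : ℝ) : fermi x ≤ 1 := by
  unfold fermi
  rw [div_le_one (by positivity)]
  linarith [Real.exp_pos x]

theorem fermi_le_exp_neg (x : ℝ) : fermi x ≤ Real.exp (-x) := by
  unfold fermi
  rw [Real.exp_neg, ← one_div]
  exact one_div_le_one_div_of_le (Real.exp_pos x) (by linarith)

theorem fermi_neg (x : ℝ) : fermi (-x) = 1 - fermi x := by
  unfold fermi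
  rw [Real.exp_neg]
  field_simp
  ring

@[fun_prop]
theorem continuous_fermi : Continuous fermi := by
  unfold fermi
  exact continuous_const.div (by fun_prop) fun x => by positivity

/-- The deviation of the Fermi function from its zero-temperature limit, the step function that
is `1` on the negative half-line. -/
noncomputable def fermiExcess (x : ℝ) : ℝ := fermi x - (Set.Iio 0).indicator 1 x

theorem measurable_fermiExcess : Measurable fermiExcess :=
  continuous_fermi.measurable.sub (measurable_one.indicator measurableSet_Iio)

theorem abs_fermiExcess_le (x : ℝ) : |fermiExcess x| ≤ Real.exp (-|x|) := by
  unfold fermiExcess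
  by_cases hx : x < 0
  · have h1 : fermi x - (Set.Iio (0 : ℝ)).indicator 1 x = -fermi (-x) := by
      rw [fermi_neg]
      simp [hx]
    rw [h1, abs_neg, abs_of_pos (fermi_pos _), abs_of_neg hx]
    exact fermi_le_exp_neg _
  · have h1 : fermi x - (Set.Iio (0 : ℝ)).indicator 1 x = fermi x := by
      simp [hx]
    rw [h1, abs_of_pos (fermi_pos _), abs_of_nonneg (not_lt.mp hx)]
    exact fermi_le_exp_neg _

/-! ### Exponentially small quantities -/

theorem exp_neg_mul_isBigO_inv_pow {c : ℝ} (hc : 0 < c) (K : ℕ) :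
    (fun β : ℝ => Real.exp (-c * β)) =O[atTop] fun β => β⁻¹ ^ K := by
  refine ((isLittleO_exp_neg_mul_rpow_atTop hc (-K)).isBigO).trans (EventuallyEq.isBigO ?_)
  filter_upwards [eventually_gt_atTop 0] with β hβ
  rw [Real.rpow_neg hβ.le, Real.rpow_natCast, inv_pow]

theorem mul_exp_neg_mul_isBigO_inv_pow {c : ℝ} (hc : 0 < c) (K : ℕ) :
    (fun β : ℝ => β * Real.exp (-c * β)) =O[atTop] fun β => β⁻¹ ^ K := by
  refine ((isBigO_refl (fun β : ℝ => β) atTop).mul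
    (exp_neg_mul_isBigO_inv_pow hc (K + 1))).trans (EventuallyEq.isBigO ?_)
  filter_upwards [eventually_gt_atTop 0] with β hβ
  rw [pow_succ', mul_inv_cancel_left₀ hβ.ne']

/-! ### The Sommerfeld expansion -/

theorem integrable_abs_pow_mul_exp_neg_abs (m : ℕ) :
    Integrable fun z : ℝ => |z| ^ m * Real.exp (-|z|) := by
  -- The integral is `2 * m!`; a non-integrable function would have integral zero.
  by_contra hcon
  have h1 := integral_comp_abs (f := fun z : ℝ => z ^ m * Real.exp (-z))
  have h2 := Real.Gamma_eq_integral (s := (m : ℝ) + 1) (by positivity)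
  have h3 : ∫ z in Set.Ioi (0 : ℝ), z ^ m * Real.exp (-z) = (m ! : ℝ) := by
    rw [← Real.Gamma_nat_eq_factorial, h2]
    refine setIntegral_congr_fun measurableSet_Ioi fun z _ => ?_
    simp [mul_comm]
  rw [integral_undef hcon, h3] at h1
  have : (m ! : ℝ) ≠ 0 := by exact_mod_cast Nat.factorial_ne_zero m
  simp_all

theorem integrable_pow_mul_exp_neg_abs (m : ℕ) :
    Integrable fun z : ℝ => z ^ m * Real.exp (-|z|) := by
  refine (integrable_abs_pow_mul_exp_neg_abs m).mono' (by fun_prop) (ae_of_all _ fun z => ?_)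
  simp

/-- The moments `∫ y ^ m * fermiExcess y`, which carry the universal constants of the Sommerfeld
expansion. They vanish for even `m`, a fact that plays no role below. -/
noncomputable def fermiMoment (m : ℕ) : ℝ := ∫ y : ℝ, y ^ m * fermiExcess y

theorem integral_pow_mul_fermiExcess {β : ℝ} (hβ : 0 < β) (m : ℕ) :
    ∫ z : ℝ, z ^ m * fermiExcess (β * z) = fermiMoment m * β⁻¹ ^ (m + 1) := by
  have h := Measure.integral_comp_mul_left (fun y : ℝ => y ^ m * fermiExcess y) β
  rw [abs_of_pos (inv_pos.mpr hβ), smul_eq_mul] at h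
  have h2 : ∫ z : ℝ, z ^ m * fermiExcess (β * z)
      = β⁻¹ ^ m * ∫ z : ℝ, (β * z) ^ m * fermiExcess (β * z) := by
    rw [← integral_const_mul]
    congr 1 with z
    rw [mul_pow, inv_pow]
    field_simp
  rw [h2, h, fermiMoment]
  ring

theorem integral_abs_pow_mul_exp_neg_mul_abs {β : ℝ} (hβ : 0 < β) (m : ℕ) :
    Integrable (fun z : ℝ => |z| ^ m * Real.exp (-(β * |z|))) ∧
    ∫ z : ℝ, |z| ^ m * Real.exp (-(β * |z|))
      = (∫ y : ℝ, |y| ^ m * Real.exp (-|y|)) * β⁻¹ ^ (m + 1) := by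
  have hf : ∀ z : ℝ, |z| ^ m * Real.exp (-(β * |z|))
      = β⁻¹ ^ m * (|β * z| ^ m * Real.exp (-|β * z|)) := by
    intro z
    rw [abs_mul, abs_of_pos hβ, mul_pow, inv_pow]
    field_simp
  have h := Measure.integral_comp_mul_left (fun y : ℝ => |y| ^ m * Real.exp (-|y|)) β
  rw [abs_of_pos (inv_pos.mpr hβ), smul_eq_mul] at h
  constructor
  · simp_rw [hf]
    exact ((integrable_abs_pow_mul_exp_neg_abs m).comp_mul_left' hβ.ne').const_mul _
  · simp_rw [hf]
    rw [integral_const_mul, h]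
    ring

/-- A version of Watson's lemma: a function that vanishes to order `K` at the origin, integrated
against the Fermi excess at inverse temperature `β`, gives `O(β ^ (-K - 1))`. -/
theorem integral_mul_fermiExcess_isBigO {D : ℝ → ℝ} {K : ℕ} {δ C : ℝ} (hδ : 0 < δ)
    (hint : Integrable fun z => D z * Real.exp (-|z|))
    (hD : ∀ z, |z| ≤ δ → |D z| ≤ C * |z| ^ K) :
    (fun β : ℝ => ∫ z, D z * fermiExcess (β * z)) =O[atTop] fun β => β⁻¹ ^ (K + 1) := by
  have hC : 0 ≤ C := by
    have := (abs_nonneg _).trans (hD δ (abs_of_pos hδ).le)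
    exact nonneg_of_mul_nonneg_left this (by positivity)
  set A := ∫ y : ℝ, |y| ^ K * Real.exp (-|y|)
  set B := ∫ z, |D z| * Real.exp (-|z|)
  have hint' : Integrable fun z => |D z| * Real.exp (-|z|) := by
    simpa [norm_mul, Real.norm_eq_abs] using hint.norm
  have hbound : ∀ β : ℝ, 1 ≤ β → ‖∫ z, D z * fermiExcess (β * z)‖
      ≤ C * A * β⁻¹ ^ (K + 1) + B * Real.exp δ * Real.exp (-δ * β) := by
    intro β hβ
    have hβ0 : 0 < β := by linarith
    obtain ⟨hi, he⟩ := integral_abs_pow_mul_exp_neg_mul_abs hβ0 K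
    have hpt : ∀ z, ‖D z * fermiExcess (β * z)‖ ≤ C * (|z| ^ K * Real.exp (-(β * |z|)))
        + Real.exp (-((β - 1) * δ)) * (|D z| * Real.exp (-|z|)) := by
      intro z
      have h1 : |fermiExcess (β * z)| ≤ Real.exp (-(β * |z|)) := by
        simpa [abs_mul, abs_of_pos hβ0] using abs_fermiExcess_le (β * z)
      rw [norm_mul, Real.norm_eq_abs, Real.norm_eq_abs]
      have h2 : |D z| * |fermiExcess (β * z)| ≤ |D z| * Real.exp (-(β * |z|)) := by gcongr
      refine h2.trans ?_
      by_cases hz : |z| ≤ δ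
      · have := hD z hz
        have h3 : |D z| * Real.exp (-(β * |z|)) ≤ C * |z| ^ K * Real.exp (-(β * |z|)) := by gcongr
        have h4 : 0 ≤ Real.exp (-((β - 1) * δ)) * (|D z| * Real.exp (-|z|)) := by positivity
        linarith
      · have h3 : Real.exp (-(β * |z|)) ≤ Real.exp (-((β - 1) * δ)) * Real.exp (-|z|) := by
          rw [← Real.exp_add]
          apply Real.exp_le_exp.mpr
          nlinarith [not_le.mp hz]
        have h4 : 0 ≤ C * (|z| ^ K * Real.exp (-(β * |z|))) := by positivity
        have h5 : |D z| * Real.exp (-(β * |z|))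
            ≤ |D z| * (Real.exp (-((β - 1) * δ)) * Real.exp (-|z|)) := by gcongr
        linarith
    refine (norm_integral_le_of_norm_le
      ((hi.const_mul C).add (hint'.const_mul _)) (ae_of_all _ hpt)).trans (le_of_eq ?_)
    simp only [Pi.add_apply]
    rw [integral_add (hi.const_mul C) (hint'.const_mul _), integral_const_mul,
      integral_const_mul, he, show -((β - 1) * δ) = δ + -δ * β by ring, Real.exp_add]
    ring
  have hO : (fun β : ℝ => C * A * β⁻¹ ^ (K + 1) + B * Real.exp δ * Real.exp (-δ * β))
      =O[atTop] fun β => β⁻¹ ^ (K + 1) :=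
    ((isBigO_refl _ _).const_mul_left _).add
      ((exp_neg_mul_isBigO_inv_pow hδ (K + 1)).const_mul_left _)
  refine IsBigO.trans (IsBigO.of_bound 1 ?_) hO
  filter_upwards [eventually_ge_atTop 1] with β hβ
  rw [one_mul]
  exact (hbound β hβ).trans (le_abs_self _)

/-- For all `s`, on either side of the step at `h`, the Fermi factor is dominated by one fixed
integrable exponential, uniformly in `β ≥ 1`. -/
theorem fermi_mul_sub_le {β : ℝ} (hβ : 1 ≤ β) (h s : ℝ) :
    fermi (β * (s - h)) ≤ Real.exp h * Real.exp (-s) := by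
  rw [← Real.exp_add]
  rcases le_total h s with hs | hs
  · refine (fermi_le_exp_neg _).trans (Real.exp_le_exp.mpr ?_)
    nlinarith
  · exact (fermi_le_one _).trans (Real.one_le_exp (by linarith))

theorem integrableOn_mul_fermi {w : ℝ → ℝ} {S : Set ℝ}
    (hw : IntegrableOn (fun s => w s * Real.exp (-s)) S) (h : ℝ) {β : ℝ} (hβ : 1 ≤ β) :
    IntegrableOn (fun s => w s * fermi (β * (s - h))) S := by
  have hg : (fun s => w s * fermi (β * (s - h)))
      = fun s => (w s * Real.exp (-s)) * (Real.exp s * fermi (β * (s - h))) := by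
    funext s
    rw [Real.exp_neg]
    field_simp
  rw [hg]
  refine hw.mul_bdd (c := Real.exp h) (by fun_prop) (ae_of_all _ fun s => ?_)
  rw [Real.norm_eq_abs, abs_of_pos (mul_pos (Real.exp_pos _) (fermi_pos _))]
  calc Real.exp s * fermi (β * (s - h)) ≤ Real.exp s * (Real.exp h * Real.exp (-s)) := by
        gcongr
        exact fermi_mul_sub_le hβ h s
    _ = Real.exp h := by rw [Real.exp_neg]; field_simp

/-- The coefficients of the Sommerfeld expansion of `∫_0^∞ w(s) / (e ^ (β (s - h)) + 1) ds`, where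
`w` has Taylor coefficients `α` at `h`. -/
noncomputable def sommerfeldCoeff (w : ℝ → ℝ) (h : ℝ) (α : ℕ → ℝ) : ℕ → ℝ
  | 0 => ∫ s in Set.Ioo 0 h, w s
  | m + 1 => α m * fermiMoment m

theorem integrableOn_Ioo_of_mul_exp {w : ℝ → ℝ}
    (hw : IntegrableOn (fun s => w s * Real.exp (-s)) (Set.Ioi 0)) (h : ℝ) :
    IntegrableOn w (Set.Ioo 0 h) := by
  have h1 := (hw.mono_set (Set.Ioo_subset_Ioi_self : Set.Ioo 0 h ⊆ _))
  have hg : w = fun s => (w s * Real.exp (-s)) * Real.exp s := by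
    funext s
    rw [Real.exp_neg]
    field_simp
  rw [hg]
  refine Integrable.mul_bdd (c := Real.exp h) h1 (by fun_prop) ?_
  filter_upwards [ae_restrict_mem measurableSet_Ioo] with s hs
  rw [Real.norm_eq_abs, Real.abs_exp]
  exact Real.exp_le_exp.mpr hs.2.le

/-- The step function splits off `∫_0^h w`, and what is left lives within `O(1/β)` of `h`. -/
theorem integral_mul_fermi_eq {w : ℝ → ℝ}
    (hw : IntegrableOn (fun s => w s * Real.exp (-s)) (Set.Ioi 0)) (h : ℝ) {β : ℝ} (hβ : 1 ≤ β) :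
    ∫ s in Set.Ioi 0, w s * fermi (β * (s - h)) = (∫ s in Set.Ioo 0 h, w s)
      + ∫ z, (Set.Ioi 0).indicator w (z + h) * fermiExcess (β * z) := by
  have hβ0 : 0 < β := by linarith
  have h1 := integrableOn_mul_fermi hw h hβ
  have hstep : ∀ s, (Set.Iio (0 : ℝ)).indicator (1 : ℝ → ℝ) (β * (s - h))
      = (Set.Iio h).indicator 1 s := by
    intro s
    by_cases hs : s < h
    · have : β * (s - h) < 0 := mul_neg_of_pos_of_neg hβ0 (by linarith)
      simp [hs, this]
    · have : ¬ β * (s - h) < 0 := not_lt.mpr (mul_nonneg hβ0.le (by linarith))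
      simp [hs, this]
  have h2 : IntegrableOn (fun s => (Set.Iio h).indicator w s) (Set.Ioi 0) := by
    rw [IntegrableOn, integrable_indicator_iff measurableSet_Iio, IntegrableOn,
      Measure.restrict_restrict measurableSet_Iio, Set.inter_comm, Set.Ioi_inter_Iio]
    exact integrableOn_Ioo_of_mul_exp hw h
  have h3 : ∫ s in Set.Ioo 0 h, w s = ∫ s in Set.Ioi 0, (Set.Iio h).indicator w s := by
    rw [setIntegral_indicator measurableSet_Iio, Set.Ioi_inter_Iio]
  have h4 : ∫ z, (Set.Ioi 0).indicator w (z + h) * fermiExcess (β * z)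
      = ∫ s in Set.Ioi 0, w s * fermiExcess (β * (s - h)) := by
    rw [← integral_indicator measurableSet_Ioi, ← integral_sub_right_eq_self _ h]
    congr 1 with s
    by_cases hs : 0 < s <;> simp [hs]
  rw [h3, h4, ← sub_eq_iff_eq_add', ← integral_sub h1 h2]
  refine setIntegral_congr_fun measurableSet_Ioi fun s _ => ?_
  simp only [fermiExcess, hstep]
  by_cases hs : s < h <;> simp [hs]
  ring

/-- The Sommerfeld expansion, to all orders. -/
theorem hasPowerExpansion_sommerfeld {w : ℝ → ℝ} {h δ : ℝ} {α : ℕ → ℝ} (hδ : 0 < δ) (hδh : δ < h)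
    (hw : IntegrableOn (fun s => w s * Real.exp (-s)) (Set.Ioi 0))
    (hα : ∀ K : ℕ, ∃ C : ℝ, ∀ z, |z| ≤ δ →
      |w (h + z) - ∑ m ∈ Finset.range K, α m * z ^ m| ≤ C * |z| ^ K) :
    HasPowerExpansion atTop (fun β : ℝ => β⁻¹)
      (fun β => ∫ s in Set.Ioi 0, w s * fermi (β * (s - h))) (sommerfeldCoeff w h α) := by
  set W : ℝ → ℝ := fun z => (Set.Ioi 0).indicator w (z + h) with hW
  have hWint : Integrable fun z => W z * Real.exp (-|z|) := by
    have h1 : Integrable fun s => (Set.Ioi (0 : ℝ)).indicator (fun s => w s * Real.exp (-s)) s :=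
      (integrable_indicator_iff measurableSet_Ioi).mpr hw
    have h2 := h1.comp_add_right h
    have h3 : (fun z => W z * Real.exp (-|z|)) = fun z =>
        (Set.Ioi (0 : ℝ)).indicator (fun s => w s * Real.exp (-s)) (z + h)
          * (Real.exp (z + h) * Real.exp (-|z|)) := by
      funext z
      by_cases hz : 0 < z + h
      · simp only [hW, Set.mem_Ioi, hz, Set.indicator_of_mem, Real.exp_neg (z + h)]
        field_simp
      · simp [hW, hz]
    rw [h3]
    refine h2.mul_bdd (c := Real.exp h) (by fun_prop) (ae_of_all _ fun z => ?_)
    rw [← Real.exp_add, Real.norm_eq_abs, Real.abs_exp]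
    exact Real.exp_le_exp.mpr (by linarith [le_abs_self z])
  have key : ∀ K : ℕ, (fun β : ℝ => (∫ s in Set.Ioi 0, w s * fermi (β * (s - h)))
      - ∑ m ∈ Finset.range (K + 1), sommerfeldCoeff w h α m * β⁻¹ ^ m)
        =O[atTop] fun β => β⁻¹ ^ (K + 1) := by
    intro K
    obtain ⟨C, hC⟩ := hα K
    have hPint : Integrable fun z : ℝ =>
        (∑ m ∈ Finset.range K, α m * z ^ m) * Real.exp (-|z|) := by
      simp_rw [Finset.sum_mul, mul_assoc]
      exact integrable_finsetSum _ fun m _ => (integrable_pow_mul_exp_neg_abs m).const_mul _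
    have hO := integral_mul_fermiExcess_isBigO (K := K) (C := C)
      (D := fun z => W z - ∑ m ∈ Finset.range K, α m * z ^ m) hδ
      (by simpa only [sub_mul] using! hWint.sub hPint) (fun z hz => by
        have : 0 < z + h := by linarith [neg_abs_le z]
        rw [hW]
        simpa [this, add_comm h z] using hC z hz)
    refine hO.congr' ?_ EventuallyEq.rfl
    filter_upwards [eventually_ge_atTop 1] with β hβ
    have hβ0 : 0 < β := by linarith
    have hmeas : Measurable fun z : ℝ => fermiExcess (β * z) :=
      measurable_fermiExcess.comp (by fun_prop)
    have hI : ∀ f : ℝ → ℝ, Integrable (fun z => f z * Real.exp (-|z|)) →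
        Integrable fun z => f z * fermiExcess (β * z) := by
      intro f hf
      have : (fun z => f z * fermiExcess (β * z))
          = fun z => (f z * Real.exp (-|z|)) * (Real.exp |z| * fermiExcess (β * z)) := by
        funext z
        rw [Real.exp_neg]
        field_simp
      rw [this]
      refine hf.mul_bdd (c := 1)
        ((by fun_prop : Measurable fun z : ℝ => Real.exp |z|).mul hmeas).aestronglyMeasurable
        (ae_of_all _ fun z => ?_)
      rw [norm_mul, Real.norm_eq_abs, Real.norm_eq_abs, Real.abs_exp]
      calc Real.exp |z| * |fermiExcess (β * z)|
          ≤ Real.exp |z| * Real.exp (-|β * z|) := by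
            gcongr
            exact abs_fermiExcess_le _
        _ = Real.exp (|z| - β * |z|) := by
            rw [← Real.exp_add, abs_mul, abs_of_pos hβ0]
            rfl
        _ ≤ 1 := Real.exp_le_one_iff.mpr (by nlinarith [abs_nonneg z])
    rw [integral_mul_fermi_eq hw h hβ, Finset.sum_range_succ']
    simp_rw [sub_mul]
    rw [integral_sub (hI _ hWint) (hI _ hPint)]
    simp_rw [Finset.sum_mul, mul_assoc]
    rw [integral_finsetSum _ fun m _ => by
      have := hI (fun z => z ^ m) (integrable_pow_mul_exp_neg_abs m)
      exact this.const_mul _]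
    simp_rw [integral_const_mul, integral_pow_mul_fermiExcess hβ0, sommerfeldCoeff, mul_assoc]
    simp only [hW, pow_zero, mul_one]
    ring
  intro K
  rcases K with _ | K
  · have h1 := key 0
    have h2 : (fun β : ℝ => β⁻¹) =O[atTop] fun _ => (1 : ℝ) :=
      (tendsto_inv_atTop_zero).isBigO_one ℝ
    simp only [zero_add, Finset.sum_range_one, pow_zero, mul_one, pow_one] at h1
    simp only [Finset.range_zero, Finset.sum_empty, sub_zero, pow_zero]
    simpa using (h1.trans h2).add (isBigO_const_const (sommerfeldCoeff w h α 0) one_ne_zero atTop)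
  · exact key K

/-! ### The binomial series of exponent `-1/2` -/

/-- The Taylor coefficients `((2n-1)!!)² / (2n)! = (2n-1)!! / (2n)!!` of `(1 - x) ^ (-1/2)`. -/
noncomputable def invSqrtCoeff (n : ℕ) : ℝ := ((2 * n - 1)‼ : ℝ) ^ 2 / ((2 * n)! : ℝ)

theorem invSqrtCoeff_pos (n : ℕ) : 0 < invSqrtCoeff n := by
  have := Nat.doubleFactorial_pos (2 * n - 1)
  have := Nat.factorial_pos (2 * n)
  unfold invSqrtCoeff
  positivity

theorem invSqrtCoeff_zero : invSqrtCoeff 0 = 1 := by simp [invSqrtCoeff]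

theorem invSqrtCoeff_succ (n : ℕ) :
    (n + 1) * invSqrtCoeff (n + 1) = (n + 1 / 2) * invSqrtCoeff n := by
  have h1 : ((2 * (n + 1) - 1)‼ : ℝ) = (2 * n + 1) * ((2 * n - 1)‼ : ℝ) := by
    rw [show 2 * (n + 1) - 1 = 2 * n + 1 by omega, Nat.doubleFactorial_add_one]
    push_cast
    ring
  have h2 : ((2 * (n + 1))! : ℝ) = (2 * n + 2) * (2 * n + 1) * ((2 * n)! : ℝ) := by
    rw [show 2 * (n + 1) = 2 * n + 1 + 1 by ring, Nat.factorial_succ, Nat.factorial_succ]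
    push_cast
    ring
  have h3 : ((2 * n)! : ℝ) ≠ 0 := by exact_mod_cast Nat.factorial_ne_zero _
  unfold invSqrtCoeff
  rw [h1, h2]
  field_simp

theorem invSqrtCoeff_le_one (n : ℕ) : invSqrtCoeff n ≤ 1 := by
  induction n with
  | zero => rw [invSqrtCoeff_zero]
  | succ n ih =>
    have h := invSqrtCoeff_succ n
    have := invSqrtCoeff_pos n
    by_contra! hc
    nlinarith [Nat.cast_nonneg (α := ℝ) n]

theorem invSqrtCoeff_eq_multichoose (n : ℕ) :
    invSqrtCoeff n = Ring.multichoose (1 / 2 : ℝ) n := by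
  have h := Ring.factorial_nsmul_multichoose_eq_ascPochhammer (1 / 2 : ℝ)
  have h2 : ∀ n : ℕ, (n ! : ℝ) * Ring.multichoose (1 / 2 : ℝ) n
      = (ascPochhammer ℝ n).eval (1 / 2 : ℝ) := by
    intro n
    rw [← nsmul_eq_mul, h, Polynomial.ascPochhammer_smeval_eq_eval]
  induction n with
  | zero => rw [invSqrtCoeff_zero, Ring.multichoose_zero_right]
  | succ n ih =>
    have h3 : ((n + 1)! : ℝ) ≠ 0 := by exact_mod_cast Nat.factorial_ne_zero _
    apply mul_left_cancel₀ h3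
    rw [h2, ascPochhammer_succ_eval, ← h2, ← ih, Nat.factorial_succ]
    push_cast
    linear_combination (n ! : ℝ) * invSqrtCoeff_succ n

theorem hasSum_invSqrtCoeff {x : ℝ} (hx : |x| < 1) :
    HasSum (fun n => invSqrtCoeff n * x ^ n) (1 / √(1 - x)) := by
  have h := (Real.one_div_one_sub_rpow_hasFPowerSeriesOnBall_zero (1 / 2)).hasSum (y := x)
    (by simpa [enorm_eq_nnnorm, ← NNReal.coe_lt_coe] using hx)
  rw [zero_add, ← Real.sqrt_eq_rpow] at h
  have hterm : (fun n => invSqrtCoeff n * x ^ n) = fun n =>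
      (FormalMultilinearSeries.ofScalars ℝ fun n : ℕ =>
        Ring.choose ((1 / 2 : ℝ) + n - 1) n) n fun _ => x := by
    funext n
    rw [FormalMultilinearSeries.ofScalars_apply_eq, invSqrtCoeff_eq_multichoose,
      Ring.multichoose_eq, smul_eq_mul]
  rw [hterm]
  exact h

/-! ### The density of states and its Taylor expansion -/

/-- The coefficient function `c_n s ^ (2n) / J ^ (2n+1)` whose Fermi integral is `π` times the
`n`-th term of the low-temperature series. -/
noncomputable def densityTerm (J : ℝ) (n : ℕ) (s : ℝ) : ℝ :=
  invSqrtCoeff n * s ^ (2 * n) / J ^ (2 * n + 1)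

/-- The density of states of the chain, up to the factor `1 / π`. For `|s| ≥ J`, outside the band,
the square root of a non-positive number is zero, and so is the quotient. -/
noncomputable def bandDensity (J s : ℝ) : ℝ := 1 / √(J ^ 2 - s ^ 2)

theorem bandDensity_nonneg (J s : ℝ) : 0 ≤ bandDensity J s := by unfold bandDensity; positivity

theorem bandDensity_eq_zero {J s : ℝ} (hJ : 0 < J) (hs : J ≤ s) : bandDensity J s = 0 := by
  rw [bandDensity, Real.sqrt_eq_zero_of_nonpos (by nlinarith), div_zero]

theorem densityTerm_nonneg {J : ℝ} (hJ : 0 < J) (n : ℕ) (s : ℝ) : 0 ≤ densityTerm J n s := by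
  have := invSqrtCoeff_pos n
  have := (even_two_mul n).pow_nonneg s
  unfold densityTerm
  positivity

theorem densityTerm_le {J : ℝ} (hJ : 0 < J) (n : ℕ) (s : ℝ) :
    densityTerm J n s ≤ ((s / J) ^ 2) ^ n / J := by
  have : densityTerm J n s = invSqrtCoeff n * (((s / J) ^ 2) ^ n / J) := by
    rw [densityTerm, div_pow, div_pow, ← pow_mul, ← pow_mul, pow_succ]
    field_simp
  rw [this]
  exact mul_le_of_le_one_left (by positivity) (invSqrtCoeff_le_one n)

theorem hasSum_densityTerm {J s : ℝ} (hs : |s| < J) :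
    HasSum (fun n => densityTerm J n s) (bandDensity J s) := by
  have hJ : 0 < J := (abs_nonneg s).trans_lt hs
  have hx : |(s / J) ^ 2| < 1 := by
    rw [abs_pow, abs_div, abs_of_pos hJ]
    exact pow_lt_one₀ (by positivity) ((div_lt_one hJ).mpr hs) two_ne_zero
  have h := (hasSum_invSqrtCoeff hx).mul_right J⁻¹
  have h1 : J ^ 2 - s ^ 2 = J ^ 2 * (1 - (s / J) ^ 2) := by field_simp
  rw [bandDensity, h1, Real.sqrt_mul (by positivity), Real.sqrt_sq hJ.le]
  have hterm : (fun n => densityTerm J n s)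
      = fun n => invSqrtCoeff n * ((s / J) ^ 2) ^ n * J⁻¹ := by
    funext n
    rw [densityTerm, div_pow, div_pow, ← pow_mul, ← pow_mul, pow_succ]
    field_simp
  rw [hterm, mul_comm J, ← div_div, div_eq_mul_inv _ J]
  exact h

/-- Taylor's formula for a power, with the remainder controlled by the same power at the edge of
the disc: all binomial coefficients are positive. -/
theorem abs_add_pow_sub_sum_le {h z δ : ℝ} (hh : 0 ≤ h) (hδ : 0 < δ) (hz : |z| ≤ δ) (p K : ℕ) :
    |(h + z) ^ p - ∑ m ∈ Finset.range K, (p.choose m * h ^ (p - m)) * z ^ m|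
      ≤ (h + δ) ^ p * (|z| / δ) ^ K := by
  set M := max (p + 1) K
  have hexp : ∀ y : ℝ, (h + y) ^ p = ∑ m ∈ Finset.range M, (p.choose m * h ^ (p - m)) * y ^ m := by
    intro y
    rw [add_comm, add_pow]
    refine (Finset.sum_subset (Finset.range_mono (le_max_left _ _)) fun m _ hm => ?_).trans
      (Finset.sum_congr rfl fun m _ => by ring)
    rw [Nat.choose_eq_zero_of_lt (by simpa using hm)]
    simp
  have hd : |z| / δ ≤ 1 := (div_le_one hδ).mpr hz
  rw [hexp z, hexp δ, ← Finset.sum_range_add_sum_Ico _ (le_max_right _ _ : K ≤ M),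
    add_sub_cancel_left, Finset.sum_mul]
  refine (Finset.abs_sum_le_sum_abs _ _).trans
    ((Finset.sum_le_sum fun m hm => ?_).trans (Finset.sum_le_sum_of_subset_of_nonneg
      (by
        rw [Finset.range_eq_Ico]
        exact Finset.Ico_subset_Ico_left (Nat.zero_le K)) fun m _ _ => by positivity))
  rw [abs_mul, abs_pow, abs_of_nonneg (by positivity), mul_assoc]
  simp only [mul_assoc]
  gcongr _ * (_ * ?_)
  calc |z| ^ m = δ ^ m * (|z| / δ) ^ m := by rw [div_pow]; field_simp
    _ ≤ δ ^ m * (|z| / δ) ^ K := by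
      gcongr ?_ * ?_
      exact pow_le_pow_of_le_one (by positivity) hd (Finset.mem_Ico.mp hm).1

/-- The Taylor coefficients at `h` of `densityTerm J n`. -/
noncomputable def densityTaylor (J h : ℝ) (n m : ℕ) : ℝ :=
  invSqrtCoeff n / J ^ (2 * n + 1) * ((2 * n).choose m * h ^ (2 * n - m))

theorem abs_densityTerm_sub_sum_le {J h z δ : ℝ} (hJ : 0 < J) (hh : 0 ≤ h) (hδ : 0 < δ)
    (hz : |z| ≤ δ) (n K : ℕ) :
    |densityTerm J n (h + z) - ∑ m ∈ Finset.range K, densityTaylor J h n m * z ^ m|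
      ≤ densityTerm J n (h + δ) / δ ^ K * |z| ^ K := by
  have hc := invSqrtCoeff_pos n
  have h1 : densityTerm J n (h + z) - ∑ m ∈ Finset.range K, densityTaylor J h n m * z ^ m
      = invSqrtCoeff n / J ^ (2 * n + 1) * ((h + z) ^ (2 * n)
        - ∑ m ∈ Finset.range K, ((2 * n).choose m * h ^ (2 * n - m)) * z ^ m) := by
    rw [mul_sub, Finset.mul_sum]
    simp_rw [densityTerm, densityTaylor, mul_assoc]
    ring
  rw [h1, abs_mul, abs_of_pos (by positivity)]
  calc _ ≤ invSqrtCoeff n / J ^ (2 * n + 1) * ((h + δ) ^ (2 * n) * (|z| / δ) ^ K) := by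
        gcongr
        exact abs_add_pow_sub_sum_le hh hδ hz _ _
    _ = _ := by
        rw [densityTerm, div_pow]
        ring

theorem summable_densityTaylor {J h δ : ℝ} (hh : 0 ≤ h) (hδ : 0 < δ) (hJ : h + δ < J) (m : ℕ) :
    Summable fun n => densityTaylor J h n m := by
  have hJ0 : 0 < J := by linarith
  have hs := (hasSum_densityTerm (J := J) (s := h + δ) (by
    rwa [abs_of_nonneg (by linarith)])).summable
  refine Summable.of_nonneg_of_le (fun n => ?_) (fun n => ?_) (hs.div_const (δ ^ m))
  · have := invSqrtCoeff_pos n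
    unfold densityTaylor
    positivity
  · have hc := invSqrtCoeff_pos n
    have h1 : ((2 * n).choose m * h ^ (2 * n - m)) * δ ^ m ≤ (h + δ) ^ (2 * n) := by
      rcases le_or_gt m (2 * n) with hm | hm
      · rw [add_comm h, add_pow]
        refine le_trans (le_of_eq (by ring)) (Finset.single_le_sum
          (f := fun m => δ ^ m * h ^ (2 * n - m) * ((2 * n).choose m : ℝ))
          (fun i _ => by positivity) (Finset.mem_range.mpr (Nat.lt_succ_of_le hm)))
      · rw [Nat.choose_eq_zero_of_lt hm]
        simpa using by positivity
    rw [le_div_iff₀ (by positivity), densityTaylor, densityTerm, mul_assoc, mul_div_right_comm]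
    gcongr

/-- The Taylor expansion of the density of states at an interior point of the band is the sum of
those of its terms, with a uniform remainder. -/
theorem exists_abs_bandDensity_sub_sum_le {J h δ : ℝ} (hh : 0 ≤ h) (hδ : 0 < δ) (hJ : h + δ < J)
    (K : ℕ) : ∃ C : ℝ, ∀ z, |z| ≤ δ → |bandDensity J (h + z)
      - ∑ m ∈ Finset.range K, (∑' n, densityTaylor J h n m) * z ^ m| ≤ C * |z| ^ K := by
  have hJ0 : 0 < J := by linarith
  have hs : HasSum (fun n => densityTerm J n (h + δ)) (bandDensity J (h + δ)) :=
    hasSum_densityTerm (by rwa [abs_of_nonneg (by linarith)])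
  refine ⟨bandDensity J (h + δ) / δ ^ K, fun z hz => ?_⟩
  have h1 : HasSum (fun n => densityTerm J n (h + z)
      - ∑ m ∈ Finset.range K, densityTaylor J h n m * z ^ m) (bandDensity J (h + z)
      - ∑ m ∈ Finset.range K, (∑' n, densityTaylor J h n m) * z ^ m) := by
    refine (hasSum_densityTerm ?_).sub (hasSum_sum fun m _ =>
      (summable_densityTaylor hh hδ hJ m).hasSum.mul_right _)
    rw [abs_lt]
    constructor <;> linarith [neg_abs_le z, le_abs_self z]
  have h2 := (hs.div_const (δ ^ K)).mul_right (|z| ^ K)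
  rw [← h1.tsum_eq, ← h2.tsum_eq, ← Real.norm_eq_abs]
  refine tsum_of_norm_bounded h2.summable.hasSum fun n => ?_
  exact abs_densityTerm_sub_sum_le hJ0 hh hδ hz n K

/-- The tail of the series of the density, at a point at most `ρ` from the band centre. -/
theorem abs_bandDensity_sub_sum_le {J s ρ : ℝ} (hs : |s| ≤ ρ) (hρ : ρ < J) (N : ℕ) :
    |bandDensity J s - ∑ n ∈ Finset.range N, densityTerm J n s|
      ≤ ((ρ / J) ^ 2) ^ N * (J⁻¹ * (1 - (ρ / J) ^ 2)⁻¹) := by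
  have hρ0 : 0 ≤ ρ := (abs_nonneg s).trans hs
  have hJ : 0 < J := by linarith
  have hr : (ρ / J) ^ 2 < 1 := pow_lt_one₀ (by positivity) ((div_lt_one hJ).mpr hρ) two_ne_zero
  have h1 := (hasSum_nat_add_iff' N).mpr (hasSum_densityTerm (hs.trans_lt hρ))
  have h2 := (((hasSum_geometric_of_lt_one (by positivity) hr).mul_left J⁻¹).mul_left
    (((ρ / J) ^ 2) ^ N))
  rw [← h1.tsum_eq, ← h2.tsum_eq, ← Real.norm_eq_abs]
  refine tsum_of_norm_bounded h2.summable.hasSum fun n => ?_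
  rw [Real.norm_eq_abs, abs_of_nonneg (densityTerm_nonneg hJ _ _)]
  refine (densityTerm_le hJ _ _).trans ?_
  have h3 : (s / J) ^ 2 ≤ (ρ / J) ^ 2 := by
    rw [sq_le_sq, abs_div, abs_div, abs_of_pos hJ, abs_of_nonneg hρ0]
    gcongr
  calc ((s / J) ^ 2) ^ (n + N) / J ≤ ((ρ / J) ^ 2) ^ (n + N) / J := by gcongr
    _ = _ := by rw [pow_add]; ring

theorem continuous_densityTerm (J : ℝ) (n : ℕ) : Continuous (densityTerm J n) := by
  unfold densityTerm
  fun_prop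

/-! ### Fermi integrals for the terms and for the magnetization -/

theorem integrableOn_densityTerm_mul_exp_neg (J : ℝ) (n : ℕ) :
    IntegrableOn (fun s => densityTerm J n s * Real.exp (-s)) (Set.Ioi 0) := by
  have h := ((integrable_pow_mul_exp_neg_abs (2 * n)).integrableOn (s := Set.Ioi 0)).const_mul
    (invSqrtCoeff n / J ^ (2 * n + 1))
  refine IntegrableOn.congr_fun h (fun s hs => ?_) measurableSet_Ioi
  simp only [densityTerm, abs_of_pos (Set.mem_Ioi.mp hs)]
  ring

/-- The polylogarithm of the low-temperature series is a Fermi integral of a power. -/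
theorem magnetizationTerm_eq {J h β : ℝ} (hβ : 0 < β) (n : ℕ) :
    magnetizationTerm J h n β
      = 1 / Real.pi * ∫ s in Set.Ioi 0, densityTerm J n s * fermi (β * (s - h)) := by
  have h1 : polylog (2 * n + 1) (-Real.exp (β * h))
      = -(1 / ((2 * n)! : ℝ)) * ∫ t in Set.Ioi (0 : ℝ), t ^ (2 * n) * fermi (t - β * h) := by
    rw [polylog, Nat.add_sub_cancel, neg_div, neg_mul, neg_mul, div_eq_mul_one_div, mul_comm
      (Real.exp _), mul_assoc, ← integral_const_mul]
    congr 2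
    refine setIntegral_congr_fun measurableSet_Ioi fun t _ => ?_
    simp only [fermi, Real.exp_sub, sub_neg_eq_add]
    field_simp
  have h2 := integral_comp_mul_left_Ioi
    (fun t : ℝ => t ^ (2 * n) * fermi (t - β * h)) 0 hβ
  rw [mul_zero, smul_eq_mul] at h2
  have h3 : ∫ s in Set.Ioi 0, densityTerm J n s * fermi (β * (s - h))
      = invSqrtCoeff n / (J ^ (2 * n + 1) * β ^ (2 * n)) *
        ∫ s in Set.Ioi (0 : ℝ), (β * s) ^ (2 * n) * fermi (β * s - β * h) := by
    rw [← integral_const_mul]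
    refine setIntegral_congr_fun measurableSet_Ioi fun s _ => ?_
    simp only [densityTerm, mul_sub, mul_pow]
    field_simp
  rw [h3, h2, magnetizationTerm, h1, invSqrtCoeff, mul_pow β J, pow_succ β]
  simp only [div_eq_mul_inv, mul_inv]
  ring

theorem image_neg_mul_cos {J : ℝ} (hJ : 0 < J) :
    (fun k => -(J * Real.cos k)) '' Set.Ioo (Real.pi / 2) Real.pi = Set.Ioo 0 J := by
  have hpi := Real.pi_pos
  ext s
  constructor
  · rintro ⟨k, ⟨hk1, hk2⟩, rfl⟩
    have h1 : Real.cos k < 0 := Real.cos_neg_of_pi_div_two_lt_of_lt hk1 (by linarith)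
    have h2 : -1 < Real.cos k := by
      rw [← Real.cos_pi]
      exact Real.cos_lt_cos_of_nonneg_of_le_pi (by linarith) le_rfl hk2
    constructor <;> nlinarith
  · rintro ⟨hs0, hsJ⟩
    have h0 : 0 < s / J := by positivity
    have h1 : s / J < 1 := (div_lt_one hJ).mpr hsJ
    refine ⟨Real.arccos (-(s / J)), ⟨?_, ?_⟩, ?_⟩
    · rw [Real.arccos_neg]
      linarith [Real.arccos_lt_pi_div_two.mpr h0]
    · rw [Real.arccos_neg]
      linarith [Real.arccos_pos.mpr h1]
    · simp only
      rw [Real.cos_arccos (by linarith) (by linarith)]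
      field_simp

theorem injOn_neg_mul_cos {J : ℝ} (hJ : 0 < J) :
    Set.InjOn (fun k => -(J * Real.cos k)) (Set.Ioo (Real.pi / 2) Real.pi) := by
  have hpi := Real.pi_pos
  intro x hx y hy hxy
  refine Real.injOn_cos ⟨by linarith [hx.1], hx.2.le⟩ ⟨by linarith [hy.1], hy.2.le⟩ ?_
  simpa [hJ.ne'] using hxy

theorem hasDerivWithinAt_neg_mul_cos (J k : ℝ) (S : Set ℝ) :
    HasDerivWithinAt (fun k => -(J * Real.cos k)) (J * Real.sin k) S k := by
  simpa using! (((Real.hasDerivAt_cos k).const_mul J).neg).hasDerivWithinAt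

/-- The Jacobian of `s = -J cos k` is the reciprocal of the density of states. -/
theorem abs_mul_bandDensity {J k : ℝ} (hJ : 0 < J) (hk : k ∈ Set.Ioo (Real.pi / 2) Real.pi) :
    |J * Real.sin k| * bandDensity J (-(J * Real.cos k)) = 1 := by
  have hs : 0 < Real.sin k :=
    Real.sin_pos_of_pos_of_lt_pi (by linarith [hk.1, Real.pi_pos]) hk.2
  have h1 : J ^ 2 - (-(J * Real.cos k)) ^ 2 = (J * Real.sin k) ^ 2 := by
    linear_combination J ^ 2 * (-1 : ℝ) * Real.sin_sq_add_cos_sq k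
  rw [bandDensity, h1, Real.sqrt_sq (by positivity), abs_of_pos (by positivity)]
  field_simp

theorem integrableOn_bandDensity {J : ℝ} (hJ : 0 < J) :
    IntegrableOn (bandDensity J) (Set.Ioi 0) := by
  have h1 : IntegrableOn (bandDensity J) (Set.Ioo 0 J) := by
    rw [← image_neg_mul_cos hJ, integrableOn_image_iff_integrableOn_abs_deriv_smul measurableSet_Ioo
      (fun k _ => hasDerivWithinAt_neg_mul_cos J k _) (injOn_neg_mul_cos hJ)]
    refine IntegrableOn.congr_fun (f := fun _ => (1 : ℝ)) ?_
      (fun k hk => (abs_mul_bandDensity hJ hk).symm) measurableSet_Ioo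
    exact integrableOn_const (by simp)
  refine h1.of_forall_sdiff_eq_zero measurableSet_Ioi fun s hs => bandDensity_eq_zero hJ ?_
  by_contra! hc
  exact hs.2 ⟨hs.1, hc⟩

theorem integrableOn_bandDensity_mul_exp_neg {J : ℝ} (hJ : 0 < J) :
    IntegrableOn (fun s => bandDensity J s * Real.exp (-s)) (Set.Ioi 0) := by
  refine Integrable.mul_bdd (c := 1) (integrableOn_bandDensity hJ) (by fun_prop) ?_
  filter_upwards [ae_restrict_mem measurableSet_Ioi] with s hs
  rw [Real.norm_eq_abs, Real.abs_exp, Real.exp_le_one_iff]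
  linarith [Set.mem_Ioi.mp hs]

/-- The modes with `cos k < 0` give the Fermi integral of the density of states. -/
theorem integral_fermi_cos_eq {J : ℝ} (hJ : 0 < J) (h β : ℝ) :
    ∫ k in (Real.pi / 2)..Real.pi, fermi (-(β * (h + J * Real.cos k)))
      = ∫ s in Set.Ioi 0, bandDensity J s * fermi (β * (s - h)) := by
  have h1 : ∫ s in Set.Ioi 0, bandDensity J s * fermi (β * (s - h))
      = ∫ s in Set.Ioo 0 J, bandDensity J s * fermi (β * (s - h)) := by
    refine (setIntegral_eq_of_subset_of_forall_sdiff_eq_zero measurableSet_Ioi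
      Set.Ioo_subset_Ioi_self fun s hs => ?_)
    rw [bandDensity_eq_zero hJ, zero_mul]
    by_contra! hc
    exact hs.2 ⟨hs.1, hc⟩
  rw [h1, ← image_neg_mul_cos hJ, integral_image_eq_integral_abs_deriv_smul measurableSet_Ioo
      (fun k _ => hasDerivWithinAt_neg_mul_cos J k _) (injOn_neg_mul_cos hJ),
    intervalIntegral.integral_of_le (by linarith [Real.pi_pos]), integral_Ioc_eq_integral_Ioo]
  refine setIntegral_congr_fun measurableSet_Ioo fun k hk => ?_
  simp only [smul_eq_mul]
  rw [← mul_assoc, abs_mul_bandDensity hJ hk, one_mul]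
  congr 1
  ring

/-- The modes with `cos k ≥ 0` are filled up to an exponentially small correction, so that they
cancel the constant `-1/2` of the magnetization. -/
theorem abs_magnetization_sub_le {J h β : ℝ} (hJ : 0 < J) (hβ : 0 < β) :
    |magnetization J h β
      - 1 / Real.pi * ∫ s in Set.Ioi 0, bandDensity J s * fermi (β * (s - h))|
      ≤ Real.exp (-h * β) := by
  have hpi := Real.pi_pos
  set F : ℝ → ℝ := fun k => fermi (-(β * (h + J * Real.cos k))) with hF
  have hFc : Continuous F := by fun_prop
  have hFi : ∀ a b, IntervalIntegrable F volume a b := fun a b => hFc.intervalIntegrable a b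
  have heven : ∫ k in (-Real.pi)..0, F k = ∫ k in (0)..Real.pi, F k := by
    have := intervalIntegral.integral_comp_neg (a := 0) (b := Real.pi) F
    simpa [hF] using this.symm
  have hfull : ∫ k in (-Real.pi)..Real.pi, F k
      = 2 * ((∫ k in (0)..(Real.pi / 2), F k) + ∫ k in (Real.pi / 2)..Real.pi, F k) := by
    rw [← intervalIntegral.integral_add_adjacent_intervals (hFi (-Real.pi) 0) (hFi 0 Real.pi),
      heven, intervalIntegral.integral_add_adjacent_intervals (hFi _ _) (hFi _ _)]
    ring
  have hfill : ∫ k in (0)..(Real.pi / 2), F k = Real.pi / 2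
      - ∫ k in (0)..(Real.pi / 2), fermi (β * (h + J * Real.cos k)) := by
    have : F = fun k => 1 - fermi (β * (h + J * Real.cos k)) := by
      funext k
      rw [hF, ← fermi_neg]
    rw [this, intervalIntegral.integral_sub (by simp)
      ((by fun_prop : Continuous fun k => fermi (β * (h + J * Real.cos k))).intervalIntegrable _ _)]
    simp
  have hsmall : ‖∫ k in (0)..(Real.pi / 2), fermi (β * (h + J * Real.cos k))‖
      ≤ Real.exp (-h * β) * |Real.pi / 2 - 0| := by
    refine intervalIntegral.norm_integral_le_of_norm_le_const fun k hk => ?_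
    rw [Set.uIoc_of_le (by positivity)] at hk
    have hcos : 0 ≤ Real.cos k := Real.cos_nonneg_of_mem_Icc ⟨by linarith [hk.1], hk.2⟩
    rw [Real.norm_eq_abs, abs_of_pos (fermi_pos _)]
    refine (fermi_le_exp_neg _).trans (Real.exp_le_exp.mpr ?_)
    have := mul_nonneg hβ.le (mul_nonneg hJ.le hcos)
    linarith
  have hM : magnetization J h β
      - 1 / Real.pi * ∫ s in Set.Ioi 0, bandDensity J s * fermi (β * (s - h))
      = -(1 / Real.pi) * ∫ k in (0)..(Real.pi / 2), fermi (β * (h + J * Real.cos k)) := by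
    rw [← integral_fermi_cos_eq hJ]
    change -1 / 2 + 1 / (2 * Real.pi) * (∫ k in (-Real.pi)..Real.pi, F k)
      - 1 / Real.pi * (∫ k in (Real.pi / 2)..Real.pi, F k) = _
    rw [hfull, hfill]
    field_simp
    ring
  rw [hM, abs_mul, abs_neg, abs_of_pos (by positivity : 0 < 1 / Real.pi)]
  rw [Real.norm_eq_abs, sub_zero, abs_of_pos (by positivity : 0 < Real.pi / 2)] at hsmall
  calc _ ≤ 1 / Real.pi * (Real.exp (-h * β) * (Real.pi / 2)) := by gcongr
    _ = Real.exp (-h * β) / 2 := by field_simp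
    _ ≤ _ := by linarith [Real.exp_pos (-h * β)]

/-! ### Operations on power expansions and asymptotic series -/

theorem HasPowerExpansion.const_mul {α : Type*} {l : Filter α} {ε f : α → ℝ} {a : ℕ → ℝ}
    (hf : HasPowerExpansion l ε f a) (c : ℝ) :
    HasPowerExpansion l ε (fun x => c * f x) fun m => c * a m := by
  intro K
  refine ((hf K).const_mul_left c).congr_left fun x => ?_
  rw [mul_sub, Finset.mul_sum]
  simp_rw [mul_assoc]

theorem HasPowerExpansion.congr_left {α : Type*} {l : Filter α} {ε f g : α → ℝ} {a : ℕ → ℝ}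
    (hf : HasPowerExpansion l ε f a) (hfg : f =ᶠ[l] g) : HasPowerExpansion l ε g a :=
  fun K => (hf K).congr' (hfg.mono fun x hx => by simp only [hx]) EventuallyEq.rfl

/-- Corrections beyond all orders do not affect a power expansion. -/
theorem HasPowerExpansion.of_sub_isBigO {α : Type*} {l : Filter α} {ε f g : α → ℝ} {a : ℕ → ℝ}
    (hf : HasPowerExpansion l ε f a)
    (hfg : ∀ K : ℕ, (fun x => g x - f x) =O[l] fun x => ε x ^ K) : HasPowerExpansion l ε g a :=
  fun K => ((hfg K).add (hf K)).congr_left fun x => by ring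

theorem HasPowerExpansion.isBigO_one {α : Type*} {l : Filter α} {ε f : α → ℝ} {a : ℕ → ℝ}
    (hf : HasPowerExpansion l ε f a) : f =O[l] fun _ => (1 : ℝ) := by
  simpa using hf 0

theorem HasPowerExpansion.tendsto {α : Type*} {l : Filter α} {ε f : α → ℝ} {a : ℕ → ℝ}
    (hf : HasPowerExpansion l ε f a) (hε : Tendsto ε l (𝓝 0)) : Tendsto f l (𝓝 (a 0)) := by
  have h := hf 1
  simp only [Finset.sum_range_one, pow_zero, mul_one, pow_one] at h
  exact tendsto_sub_nhds_zero_iff.mp (h.trans_tendsto hε)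

theorem HasPowerExpansion.comp_rescale {α α' : Type*} {l : Filter α} {l' : Filter α'}
    {ε f : α → ℝ} {ε' : α' → ℝ} {a : ℕ → ℝ} {u : α' → α} {c : ℝ}
    (hf : HasPowerExpansion l ε f a) (hu : Tendsto u l' l) (hε : ∀ x, ε (u x) = c * ε' x) :
    HasPowerExpansion l' ε' (fun x => f (u x)) fun m => a m * c ^ m := by
  intro K
  have h := (hf K).comp_tendsto hu
  simp only [Function.comp_def, hε, mul_pow] at h
  refine (h.trans (isBigO_const_mul_self _ _ _)).congr_left fun x => ?_
  simp_rw [mul_assoc]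

/-- An asymptotic series may be rewritten in terms of another variable, if the small parameters are
proportional. -/
theorem IsAsymptoticSeries.comp_rescale {α α' : Type*} {l : Filter α} {l' : Filter α'}
    {ε f : α → ℝ} {term : ℕ → α → ℝ} {ε' : α' → ℝ} {u : α' → α} {c : ℝ}
    (hf : IsAsymptoticSeries l ε f term) (hu : Tendsto u l' l) (hε : ∀ x, ε (u x) = c * ε' x) :
    IsAsymptoticSeries l' ε' (fun x => f (u x)) fun n x => term n (u x) where
  remainder N := (hf.remainder N).comp_tendsto hu
  termwise := by
    obtain ⟨a, ha, hs, hfa⟩ := hf.termwise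
    refine ⟨fun n m => a n m * c ^ m, fun n => (ha n).comp_rescale hu hε,
      fun m => (hs m).mul_right _, ?_⟩
    simp_rw [tsum_mul_right]
    exact hfa.comp_rescale hu hε
  truncation := by
    obtain ⟨N, hN, h⟩ := hf.truncation
    refine ⟨fun x => N (u x), hN.comp hu, fun K => ?_⟩
    have h1 := (h K).comp_tendsto hu
    simp only [Function.comp_def, hε, mul_pow] at h1
    exact h1.trans (isBigO_const_mul_self _ _ _)

/-! ### Power expansions of the magnetization and of the terms -/

theorem hasSum_sommerfeldCoeff {J h δ : ℝ} (hh : 0 < h) (hδ : 0 < δ) (hJ : h + δ < J) (m : ℕ) :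
    HasSum (fun n => sommerfeldCoeff (densityTerm J n) h (densityTaylor J h n) m)
      (sommerfeldCoeff (bandDensity J) h (fun m => ∑' n, densityTaylor J h n m) m) := by
  have hJ0 : 0 < J := by linarith
  rcases m with _ | m
  · have hs := hasSum_densityTerm (J := J) (s := h) (by rw [abs_of_pos hh]; linarith)
    refine hasSum_integral_of_dominated_convergence (fun n _ => densityTerm J n h)
      (fun n => (continuous_densityTerm J n).aestronglyMeasurable) (fun n => ?_)
      (ae_of_all _ fun _ => hs.summable) (integrableOn_const (by simp)) ?_
    · filter_upwards [ae_restrict_mem measurableSet_Ioo] with s hs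
      rw [Real.norm_eq_abs, abs_of_nonneg (densityTerm_nonneg hJ0 n s), densityTerm, densityTerm]
      have := invSqrtCoeff_pos n
      have := hs.1.le
      have := hs.2.le
      gcongr
    · filter_upwards [ae_restrict_mem measurableSet_Ioo] with s hs
      refine hasSum_densityTerm ?_
      rw [abs_of_pos hs.1]
      linarith [hs.2]
  · exact (summable_densityTaylor hh.le hδ hJ m).hasSum.mul_right _

theorem sommerfeldCoeff_densityTerm_zero_pos {J h : ℝ} (hh : 0 < h) (hJ : 0 < J) (n : ℕ)
    (α : ℕ → ℝ) : 0 < sommerfeldCoeff (densityTerm J n) h α 0 := by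
  have hc := invSqrtCoeff_pos n
  have hcont := continuous_densityTerm J n
  simp only [sommerfeldCoeff]
  rw [← integral_Ioc_eq_integral_Ioo, ← intervalIntegral.integral_of_le hh.le]
  refine intervalIntegral.intervalIntegral_pos_of_pos_on (hcont.intervalIntegrable 0 h)
    (fun s hs => ?_) hh
  have := hs.1
  unfold densityTerm
  positivity

theorem hasPowerExpansion_magnetizationTerm {J h δ : ℝ} (hδ : 0 < δ) (hδh : δ < h)
    (hJ : h + δ < J) (n : ℕ) :
    HasPowerExpansion atTop (fun β : ℝ => β⁻¹) (magnetizationTerm J h n) fun m =>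
      1 / Real.pi * sommerfeldCoeff (densityTerm J n) h (densityTaylor J h n) m := by
  have hh : 0 < h := hδ.trans hδh
  refine ((hasPowerExpansion_sommerfeld hδ hδh (integrableOn_densityTerm_mul_exp_neg J n)
    fun K => ⟨_, fun z hz => abs_densityTerm_sub_sum_le (by linarith) hh.le hδ hz n K⟩).const_mul
      (1 / Real.pi)).congr_left ?_
  filter_upwards [eventually_gt_atTop 0] with β hβ
  rw [magnetizationTerm_eq hβ]

theorem magnetization_sub_isBigO {J h : ℝ} (hh : 0 < h) (hJ : 0 < J) (K : ℕ) :
    (fun β => magnetization J h β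
      - 1 / Real.pi * ∫ s in Set.Ioi 0, bandDensity J s * fermi (β * (s - h)))
      =O[atTop] fun β : ℝ => β⁻¹ ^ K := by
  refine IsBigO.trans (IsBigO.of_bound 1 ?_) (exp_neg_mul_isBigO_inv_pow hh K)
  filter_upwards [eventually_gt_atTop 0] with β hβ
  rw [one_mul, Real.norm_eq_abs, Real.norm_eq_abs, Real.abs_exp]
  exact abs_magnetization_sub_le hJ hβ

theorem hasPowerExpansion_magnetization {J h δ : ℝ} (hδ : 0 < δ) (hδh : δ < h)
    (hJ : h + δ < J) :
    HasPowerExpansion atTop (fun β : ℝ => β⁻¹) (magnetization J h) fun m =>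
      1 / Real.pi * sommerfeldCoeff (bandDensity J) h (fun m => ∑' n, densityTaylor J h n m) m := by
  have hh : 0 < h := hδ.trans hδh
  have hJ0 : 0 < J := by linarith
  exact ((hasPowerExpansion_sommerfeld hδ hδh (integrableOn_bandDensity_mul_exp_neg hJ0)
    (exists_abs_bandDensity_sub_sum_le hh.le hδ hJ)).const_mul
      (1 / Real.pi)).of_sub_isBigO (magnetization_sub_isBigO hh hJ0)

/-! ### Truncation beyond all orders -/

/-- Beyond the point `h + δ` the partial sums of the density grow like `s ^ (2N)`. As long as `N`
is at most a small multiple of `β`, half of the Fermi decay suffices to absorb that growth. -/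
theorem sum_densityTerm_le {J h δ β s : ℝ} {N : ℕ} (hh : 0 < h) (hδ : 0 < δ) (hJ : 0 < J)
    (hβ : 0 < β) (hN : N ≤ J * δ / (4 * (h + δ)) * β) (hs : h + δ ≤ s) :
    ∑ n ∈ Finset.range N, densityTerm J n s ≤ N / J * Real.exp (β * (s - h) / 2) := by
  have hs0 : 0 < s := by linarith
  have hterm : ∀ n ∈ Finset.range N, densityTerm J n s ≤ Real.exp (β * (s - h) / 2) / J := by
    intro n hn
    refine (densityTerm_le hJ n s).trans ?_
    gcongr
    have h1 : s / J ≤ Real.exp (s / J) := by linarith [Real.add_one_le_exp (s / J)]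
    have h2 : (n : ℝ) ≤ N := by exact_mod_cast (Finset.mem_range.mp hn).le
    rw [← pow_mul]
    calc (s / J) ^ (2 * n) ≤ Real.exp (s / J) ^ (2 * n) := by gcongr
      _ = Real.exp (2 * n * (s / J)) := by
        rw [← Real.exp_nat_mul]
        push_cast
        rfl
      _ ≤ Real.exp (2 * (J * δ / (4 * (h + δ)) * β) * (s / J)) := by
        gcongr
        exact h2.trans hN
      _ ≤ Real.exp (β * (s - h) / 2) := by
        apply Real.exp_le_exp.mpr
        have h3 : 2 * (J * δ / (4 * (h + δ)) * β) * (s / J)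
            = β / 2 * (δ * s / (h + δ)) := by
          field_simp
          ring
        have h4 : δ * s / (h + δ) ≤ s - h := by
          rw [div_le_iff₀ (by positivity)]
          nlinarith [mul_nonneg hh.le (sub_nonneg.mpr hs)]
        rw [h3]
        calc β / 2 * (δ * s / (h + δ)) ≤ β / 2 * (s - h) := by gcongr
          _ = _ := by ring
  refine (Finset.sum_le_sum hterm).trans (le_of_eq ?_)
  rw [Finset.sum_const, Finset.card_range, nsmul_eq_mul]
  ring

/-- For `s ≤ h + δ < J` the partial sums of the density converge geometrically; beyond `h + δ`,
both the density and its partial sums are beaten by the Fermi decay. -/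
theorem abs_bandDensity_sub_sum_mul_fermi_le {J h δ β s : ℝ} {N : ℕ} (hh : 0 < h) (hδ : 0 < δ)
    (hJ : h + δ < J) (hβ : 2 ≤ β) (hN : N ≤ J * δ / (4 * (h + δ)) * β) (hs : 0 < s) :
    |(bandDensity J s - ∑ n ∈ Finset.range N, densityTerm J n s) * fermi (β * (s - h))|
      ≤ ((((h + δ) / J) ^ 2) ^ N * (J⁻¹ * (1 - ((h + δ) / J) ^ 2)⁻¹)
        + N / J * Real.exp (-((β / 2 - 1) * δ))) * Real.exp h * Real.exp (-s)
        + Real.exp (-((β - 1) * δ)) * Real.exp h * (bandDensity J s * Real.exp (-s)) := by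
  have hJ0 : 0 < J := by linarith
  have hr : ((h + δ) / J) ^ 2 < 1 :=
    pow_lt_one₀ (by positivity) ((div_lt_one hJ0).mpr hJ) two_ne_zero
  have hr' : 0 < 1 - ((h + δ) / J) ^ 2 := by linarith
  have hw := bandDensity_nonneg J s
  rw [abs_mul, abs_of_pos (fermi_pos _)]
  rcases le_total s (h + δ) with hsρ | hsρ
  · have h1 := abs_bandDensity_sub_sum_le (J := J) (s := s) (by rwa [abs_of_pos hs]) hJ N
    have h2 := fermi_mul_sub_le (by linarith : 1 ≤ β) h s
    have h3 := mul_le_mul h1 h2 (fermi_pos _).le (by positivity)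
    have h4 : 0 ≤ N / J * Real.exp (-((β / 2 - 1) * δ)) * Real.exp h * Real.exp (-s) := by
      positivity
    have h5 : 0 ≤ Real.exp (-((β - 1) * δ)) * Real.exp h * (bandDensity J s * Real.exp (-s)) := by
      positivity
    linarith
  · have hsum := sum_densityTerm_le hh hδ hJ0 (by linarith) hN hsρ
    have hsum0 : 0 ≤ ∑ n ∈ Finset.range N, densityTerm J n s :=
      Finset.sum_nonneg fun n _ => densityTerm_nonneg hJ0 n s
    have h1 : |bandDensity J s - ∑ n ∈ Finset.range N, densityTerm J n s|
        ≤ bandDensity J s + N / J * Real.exp (β * (s - h) / 2) := by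
      rw [abs_le]
      constructor <;> linarith
    have h2 : Real.exp (-(β * (s - h)))
        ≤ Real.exp (-((β - 1) * δ)) * Real.exp h * Real.exp (-s) := by
      rw [← Real.exp_add, ← Real.exp_add]
      apply Real.exp_le_exp.mpr
      nlinarith
    have h3 : Real.exp (β * (s - h) / 2) * Real.exp (-(β * (s - h)))
        ≤ Real.exp (-((β / 2 - 1) * δ)) * Real.exp h * Real.exp (-s) := by
      rw [← Real.exp_add, ← Real.exp_add, ← Real.exp_add]
      apply Real.exp_le_exp.mpr
      nlinarith
    have h4 : 0 ≤ (((h + δ) / J) ^ 2) ^ N * (J⁻¹ * (1 - ((h + δ) / J) ^ 2)⁻¹)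
        * Real.exp h * Real.exp (-s) := by positivity
    calc _ ≤ (bandDensity J s + N / J * Real.exp (β * (s - h) / 2))
          * Real.exp (-(β * (s - h))) := by
          gcongr
          · exact (fermi_pos _).le
          · exact fermi_le_exp_neg _
      _ = bandDensity J s * Real.exp (-(β * (s - h)))
          + N / J * (Real.exp (β * (s - h) / 2) * Real.exp (-(β * (s - h)))) := by ring
      _ ≤ bandDensity J s * (Real.exp (-((β - 1) * δ)) * Real.exp h * Real.exp (-s))
          + N / J * (Real.exp (-((β / 2 - 1) * δ)) * Real.exp h * Real.exp (-s)) := by gcongr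
      _ ≤ _ := by linarith

theorem pow_floor_isBigO_inv_pow {r γ : ℝ} (hr0 : 0 < r) (hr1 : r < 1) (hγ : 0 < γ) (K : ℕ) :
    (fun β : ℝ => r ^ ⌊γ * β⌋₊) =O[atTop] fun β => β⁻¹ ^ K := by
  have hlog : Real.log r < 0 := Real.log_neg hr0 hr1
  have hc : 0 < -Real.log r * γ := mul_pos (by linarith) hγ
  refine IsBigO.trans (IsBigO.of_bound r⁻¹ (Eventually.of_forall fun β => ?_))
    (exp_neg_mul_isBigO_inv_pow hc K)
  rw [Real.norm_eq_abs, abs_of_pos (by positivity), Real.norm_eq_abs, Real.abs_exp,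
    ← Real.exp_log (pow_pos hr0 _), Real.log_pow, ← Real.exp_log (inv_pos.mpr hr0), Real.log_inv,
    ← Real.exp_add]
  apply Real.exp_le_exp.mpr
  nlinarith [Nat.lt_floor_add_one (γ * β)]

/-- Truncated after a number of terms proportional to `β`, the low-temperature series reproduces
the magnetization beyond all orders. -/
theorem magnetization_sub_sum_isBigO {J h δ : ℝ} (hh : 0 < h) (hδ : 0 < δ) (hJ : h + δ < J)
    (K : ℕ) :
    (fun β => magnetization J h β
      - ∑ n ∈ Finset.range ⌊J * δ / (4 * (h + δ)) * β⌋₊, magnetizationTerm J h n β)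
      =O[atTop] fun β : ℝ => β⁻¹ ^ K := by
  have hJ0 : 0 < J := by linarith
  set γ := J * δ / (4 * (h + δ)) with hγ
  have hγ0 : 0 < γ := by positivity
  set C := J⁻¹ * (1 - ((h + δ) / J) ^ 2)⁻¹
  set r := ((h + δ) / J) ^ 2 with hr
  have hr0 : 0 < r := by positivity
  have hr1 : r < 1 := pow_lt_one₀ (by positivity) ((div_lt_one hJ0).mpr hJ) two_ne_zero
  set B := ∫ s in Set.Ioi 0, bandDensity J s * Real.exp (-s)
  have hw := integrableOn_bandDensity_mul_exp_neg hJ0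
  have hexp : IntegrableOn (fun s : ℝ => Real.exp (-s)) (Set.Ioi 0) := integrableOn_exp_neg_Ioi 0
  have hbound : ∀ᶠ β : ℝ in atTop,
      ‖1 / Real.pi * ∫ s in Set.Ioi 0, (bandDensity J s
        - ∑ n ∈ Finset.range ⌊γ * β⌋₊, densityTerm J n s) * fermi (β * (s - h))‖
      ≤ 1 / Real.pi * ((r ^ ⌊γ * β⌋₊ * C
          + γ / J * Real.exp δ * (β * Real.exp (-(δ / 2) * β))) * Real.exp h
          + Real.exp δ * Real.exp (-δ * β) * Real.exp h * B) := by
    filter_upwards [eventually_ge_atTop 2] with β hβ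
    have hfl : (⌊γ * β⌋₊ : ℝ) ≤ γ * β := Nat.floor_le (by positivity)
    rw [norm_mul, Real.norm_eq_abs (1 / Real.pi), abs_of_pos (by positivity)]
    gcongr
    refine (norm_integral_le_of_norm_le ((hexp.const_mul _).add (hw.const_mul _))
      ((ae_restrict_mem measurableSet_Ioi).mono fun s hs =>
        abs_bandDensity_sub_sum_mul_fermi_le hh hδ hJ hβ hfl hs)).trans ?_
    simp only [Pi.add_apply]
    rw [integral_add (hexp.const_mul _) (hw.const_mul _), integral_const_mul, integral_const_mul,
      integral_exp_neg_Ioi_zero, mul_one,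
      show -((β / 2 - 1) * δ) = δ + -(δ / 2) * β by ring,
      show -((β - 1) * δ) = δ + -δ * β by ring, Real.exp_add, Real.exp_add]
    gcongr ?_ * _ + _
    have : (⌊γ * β⌋₊ : ℝ) / J * (Real.exp δ * Real.exp (-(δ / 2) * β))
        ≤ γ * β / J * (Real.exp δ * Real.exp (-(δ / 2) * β)) := by gcongr
    refine (add_le_add le_rfl this).trans (le_of_eq ?_)
    ring
  have hO : (fun β : ℝ => 1 / Real.pi * ∫ s in Set.Ioi 0, (bandDensity J s
        - ∑ n ∈ Finset.range ⌊γ * β⌋₊, densityTerm J n s) * fermi (β * (s - h)))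
      =O[atTop] fun β => β⁻¹ ^ K := by
    refine IsBigO.trans (IsBigO.of_bound 1 (hbound.mono fun β hβ => ?_))
      (g := fun β : ℝ => 1 / Real.pi * ((r ^ ⌊γ * β⌋₊ * C
          + γ / J * Real.exp δ * (β * Real.exp (-(δ / 2) * β))) * Real.exp h
          + Real.exp δ * Real.exp (-δ * β) * Real.exp h * B)) ?_
    · rw [one_mul]
      exact hβ.trans (le_abs_self _)
    · have h1 := pow_floor_isBigO_inv_pow hr0 hr1 hγ0 K
      have h2 := mul_exp_neg_mul_isBigO_inv_pow (half_pos hδ) K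
      have h3 := exp_neg_mul_isBigO_inv_pow hδ K
      refine ((((h1.const_mul_left C).add (h2.const_mul_left (γ / J * Real.exp δ))).const_mul_left
        (Real.exp h)).add (h3.const_mul_left (Real.exp δ * Real.exp h * B))).const_mul_left
        (1 / Real.pi) |>.congr_left fun β => ?_
      ring
  refine ((magnetization_sub_isBigO hh hJ0 K).add hO).congr' ?_ EventuallyEq.rfl
  filter_upwards [eventually_ge_atTop 1] with β hβ
  have h1 : ∀ n, magnetizationTerm J h n β
      = 1 / Real.pi * ∫ s in Set.Ioi 0, densityTerm J n s * fermi (β * (s - h)) :=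
    fun n => magnetizationTerm_eq (by linarith) n
  simp_rw [h1, ← Finset.mul_sum, sub_mul, Finset.sum_mul]
  rw [integral_sub (integrableOn_mul_fermi hw h hβ) (integrable_finsetSum _ fun n _ =>
      integrableOn_mul_fermi (integrableOn_densityTerm_mul_exp_neg J n) h hβ),
    integral_finsetSum _ fun n _ =>
      integrableOn_mul_fermi (integrableOn_densityTerm_mul_exp_neg J n) h hβ]
  ring

/-! ### The low-temperature series -/

theorem isAsymptoticSeries_magnetization {J h : ℝ} (hh : 0 < h) (hJ : h < J) :
    IsAsymptoticSeries atTop (fun β : ℝ => β⁻¹) (magnetization J h) (magnetizationTerm J h) := by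
  obtain ⟨δ, hδ, hδ'⟩ : ∃ δ, 0 < δ ∧ δ < min h (J - h) :=
    exists_between (lt_min hh (by linarith))
  have hδh : δ < h := hδ'.trans_le (min_le_left _ _)
  have hδJ : h + δ < J := by linarith [hδ'.trans_le (min_le_right _ _)]
  have hJ0 : 0 < J := by linarith
  have hterm := hasPowerExpansion_magnetizationTerm hδ hδh hδJ
  have hmag := hasPowerExpansion_magnetization hδ hδh hδJ
  refine ⟨fun N => ?_, ⟨_, hterm, fun m => ?_, ?_⟩,
    ⟨fun β => ⌊J * δ / (4 * (h + δ)) * β⌋₊, ?_, magnetization_sub_sum_isBigO hh hδ hδJ⟩⟩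
  · -- Every term tends to a non-zero constant, and the left-hand side is bounded.
    have hlim := (hterm N).tendsto tendsto_inv_atTop_zero
    have hne : 1 / Real.pi * sommerfeldCoeff (densityTerm J N) h (densityTaylor J h N) 0 ≠ 0 :=
      (mul_pos (by positivity) (sommerfeldCoeff_densityTerm_zero_pos hh hJ0 N _)).ne'
    have hsum : (fun β => ∑ n ∈ Finset.range N, magnetizationTerm J h n β)
        =O[atTop] fun _ => (1 : ℝ) := by
      simpa only [Finset.sum_fn] using! IsBigO.sum fun n _ => (hterm n).isBigO_one
    refine IsBigO.trans (g := fun _ => (1 : ℝ)) (hmag.isBigO_one.sub hsum) ?_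
    have hpos := norm_pos_iff.mpr hne
    exact (isBigO_const_left_iff_pos_le_norm (one_ne_zero (α := ℝ))).mpr ⟨_, half_pos hpos,
      (hlim.norm.eventually (lt_mem_nhds (half_lt_self hpos))).mono fun _ hx => hx.le⟩
  · exact (hasSum_sommerfeldCoeff hh hδ hδJ m).summable.mul_left _
  · simp_rw [tsum_mul_left, (hasSum_sommerfeldCoeff hh hδ hδJ _).tsum_eq]
    exact hmag
  · exact tendsto_nat_floor_atTop.comp (tendsto_id.const_mul_atTop (by positivity))

theorem magnetizationTerm_one_div (kB J h : ℝ) (n : ℕ) (T : ℝ) :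
    magnetizationTerm J h n (1 / (kB * T)) = -blochCoeff kB J h n T * T ^ (2 * n + 1) := by
  rw [magnetizationTerm, blochCoeff, one_div_mul_eq_div, one_div_mul_eq_div, div_pow, mul_pow]
  simp only [div_eq_mul_inv, mul_inv, inv_inv]
  ring

theorem mainTheorem5 (J h : ℝ) (hh : 0 < h) (hJ : h < J) :
    IsAsymptoticSeries atTop (fun β : ℝ => β⁻¹) (magnetization J h) (magnetizationTerm J h) ∧
    ∀ kB : ℝ, 0 < kB →
      IsAsymptoticSeries (𝓝[>] (0 : ℝ)) (fun T : ℝ => T)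
        (fun T : ℝ => magnetization J h (1 / (kB * T)))
        (fun (n : ℕ) (T : ℝ) => -blochCoeff kB J h n T * T ^ (2 * n + 1)) := by
  refine ⟨isAsymptoticSeries_magnetization hh hJ, fun kB hkB => ?_⟩
  have hu : Tendsto (fun T : ℝ => 1 / (kB * T)) (𝓝[>] 0) atTop := by
    refine (tendsto_inv_nhdsGT_zero.const_mul_atTop (inv_pos.mpr hkB)).congr fun T => ?_
    rw [one_div, mul_inv]
  simp_rw [← magnetizationTerm_one_div]
  exact (isAsymptoticSeries_magnetization hh hJ).comp_rescale (c := kB) hu fun T => by simp
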